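/- For $n\in\{6,8,12\}$ let $Q=x_0^2+x_1^2+x_2^2+x_3^2\in\mathbb{C}[x_0,x_1,x_2,x_3]$ and let $S_n$ be the homogeneous polynomial of degree $n$ given by $$S_6=\sum x_i^6+15\sum x_i^2x_j^2x_k^2,\qquad S_8=\sum x_i^8+14\sum x_i^4x_j^4+168\,x_0^2x_1^2x_2^2x_3^2,\qquad S_{12}=f_s+33\sqrt5\,f_a,$$ where, with $y_i=x_i^2$, $$f_s=2\sum y_i^5y_j-6\sum y_i^4y_j^2-12\sum y_i^4y_jy_k+14\sum y_i^3y_j^3+9\sum y_i^3y_j^2y_k+348\sum y_i^3y_jy_ky_h+30\sum y_i^2y_j^2y_k^2-270\sum y_i^2y_j^2y_hy_k,$$ $$\begin{aligned}f_a=\;&y_0^3(y_1^2y_2-y_1y_2^2+y_2^2y_3-y_2y_3^2+y_3^2y_1-y_3y_1^2)-y_1^3(y_2^2y_3-y_2y_3^2+y_3^2y_0-y_3y_0^2+y_0^2y_2-y_0y_2^2)\\&+y_2^3(y_0^2y_1-y_0y_1^2+y_1^2y_3-y_1y_3^2+y_3^2y_0-y_3y_0^2)-y_3^3(y_0^2y_1-y_0y_1^2+y_1^2y_2-y_1y_2^2+y_2^2y_0-y_2y_0^2),\end{aligned}$$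 each sum running over all distinct monomials of the indicated shape with pairwise different indices in $\{0,1,2,3\}$. Consider the pencil of surfaces of degree $n$ in $\mathbb{P}_3(\mathbb{C})$ $$F_n(\lambda):\quad S_n+\lambda\,Q^{n/2}=0,\qquad \lambda\in\mathbb{P}_1(\mathbb{C})=\mathbb{C}\cup\{\infty\},$$ where $F_n(\infty)$ is the multiple quadric $Q^{n/2}=0$. A point of a surface $F=0$ is singular if all partial derivatives $\partial F/\partial x_i$ vanish there, and the surface is smooth if it has no singular point. Then for each $n\in\{6,8,12\}$: 1. If $\lambda\neq\infty$ and $p$ is a singular point of $F_n(\lambda)$, then $p$ does not lie on the quadric $Q=0$. 2. The general surface in the pencil is smooth: $F_n(\lambda)$ is smooth for all but finitely many $\lambda\in\mathbb{P}_1(\mathbb{C})$. 3. For every $\lambda\neq\infty$ the surface $F_n(\lambda)$ has only isolated singularities; in particular it has only finitely many singular points. 4. For every $\lambda\neq\infty$ the surface $F_n(\lambda)$ is irreducible and reduced: the polynomial $S_n+\lambda Q^{n/2}$ is irreducible, the point set of $F_n(\lambda)$ is irreducible in the Zariski topology, and the ideal generated by $S_n+\lambda Q^{n/2}$ is radical.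 -/

import Mathlib

open MvPolynomial
open scoped LinearAlgebra.Projectivization OnePoint

noncomputable section

/-- Complex projective 3-space. -/
abbrev P3 : Type := ℙ ℂ (Fin 4 → ℂ)

/-- The polynomial ring `ℂ[x₀, x₁, x₂, x₃]`. -/
abbrev Poly4 : Type := MvPolynomial (Fin 4) ℂ

/-- Sum over all *distinct* monomials `v₀ ^ d₀ * v₁ ^ d₁ * v₂ ^ d₂ * v₃ ^ d₃` whose exponent
vector `d` is a rearrangement of `e`. -/
def symSum {R : Type*} [CommSemiring R] (v : Fin 4 → R) (e : Fin 4 → ℕ) : R :=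
  ∑ d ∈ Finset.univ.image (fun s : Equiv.Perm (Fin 4) => e ∘ s), ∏ i, v i ^ d i

/-- The quadratic form `x₀² + x₁² + x₂² + x₃²`. -/
def quadric : Poly4 := ∑ i, X i ^ 2

/-- `S₆ = ∑ xᵢ⁶ + 15 ∑ xᵢ² xⱼ² xₖ²`. -/
def S6 : Poly4 := symSum X ![6, 0, 0, 0] + 15 * symSum X ![2, 2, 2, 0]

/-- `S₈ = ∑ xᵢ⁸ + 14 ∑ xᵢ⁴ xⱼ⁴ + 168 x₀² x₁² x₂² x₃²`. -/
def S8 : Poly4 :=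
  symSum X ![8, 0, 0, 0] + 14 * symSum X ![4, 4, 0, 0] +
    168 * (X 0 ^ 2 * X 1 ^ 2 * X 2 ^ 2 * X 3 ^ 2)

/-- The totally symmetric part of `S₁₂`, as a function of `yᵢ = xᵢ²`. -/
def S12symm {R : Type*} [CommRing R] (y : Fin 4 → R) : R :=
  2 * symSum y ![5, 1, 0, 0] - 6 * symSum y ![4, 2, 0, 0] - 12 * symSum y ![4, 1, 1, 0]
    + 14 * symSum y ![3, 3, 0, 0] + 9 * symSum y ![3, 2, 1, 0] + 348 * symSum y ![3, 1, 1, 1]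
    + 30 * symSum y ![2, 2, 2, 0] - 270 * symSum y ![2, 2, 1, 1]

/-- The anti-symmetric part of `S₁₂` (up to the factor `33 √5`), as a function of `yᵢ = xᵢ²`. -/
def S12anti {R : Type*} [CommRing R] (y : Fin 4 → R) : R :=
  y 0 ^ 3 * (y 1 ^ 2 * y 2 - y 1 * y 2 ^ 2 + y 2 ^ 2 * y 3 - y 2 * y 3 ^ 2
      + y 3 ^ 2 * y 1 - y 3 * y 1 ^ 2)
    - y 1 ^ 3 * (y 2 ^ 2 * y 3 - y 2 * y 3 ^ 2 + y 3 ^ 2 * y 0 - y 3 * y 0 ^ 2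
      + y 0 ^ 2 * y 2 - y 0 * y 2 ^ 2)
    + y 2 ^ 3 * (y 0 ^ 2 * y 1 - y 0 * y 1 ^ 2 + y 1 ^ 2 * y 3 - y 1 * y 3 ^ 2
      + y 3 ^ 2 * y 0 - y 3 * y 0 ^ 2)
    - y 3 ^ 3 * (y 0 ^ 2 * y 1 - y 0 * y 1 ^ 2 + y 1 ^ 2 * y 2 - y 1 * y 2 ^ 2
      + y 2 ^ 2 * y 0 - y 2 * y 0 ^ 2)

/-- `S₁₂`, with `yᵢ = xᵢ²`. -/
def S12 : Poly4 :=
  S12symm (fun i => X i ^ 2) + C (33 * ((Real.sqrt 5 : ℝ) : ℂ)) * S12anti (fun i => X i ^ 2)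

/-- The invariant `Sₙ` for `n = 6, 8, 12` (other indices are not used). -/
def invariantPoly : ℕ → Poly4
  | 6 => S6
  | 8 => S8
  | 12 => S12
  | _ => 0

/-- The member of the pencil with parameter in `ℙ₁(ℂ) = ℂ ∪ {∞}`: the polynomial
`Sₙ + l Q ^ (n / 2)` for `l ∈ ℂ`, and `Q ^ (n / 2)` for `l = ∞`. -/
def pencilMember (n : ℕ) : OnePoint ℂ → Poly4
  | ∞ => quadric ^ (n / 2)
  | OnePoint.some l => invariantPoly n + C l * quadric ^ (n / 2)

/-- The point `p` lies on the zero set of `F`. For homogeneous `F` this does not depend on the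
chosen representative of `p`. -/
def VanishesAt (F : Poly4) (p : P3) : Prop := eval p.rep F = 0

/-- The surface `F = 0` in projective 3-space, as a set of points. -/
def surface (F : Poly4) : Set P3 := {p | VanishesAt F p}

/-- The singular points of the surface `F = 0`: the points of the surface at which all
partial derivatives of `F` vanish. -/
def singularPoints (F : Poly4) : Set P3 :=
  {p | VanishesAt F p ∧ ∀ i, VanishesAt (pderiv i F) p}

/-- The surface `F = 0` is smooth. -/
def IsSmoothSurface (F : Poly4) : Prop := singularPoints F = ∅

/-- The Zariski topology on projective 3-space: a basis is given by the sets on which a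
homogeneous polynomial does not vanish. -/
abbrev zariski : TopologicalSpace P3 :=
  TopologicalSpace.generateFrom
    {U | ∃ (d : ℕ) (G : Poly4), G.IsHomogeneous d ∧ U = {p | ¬ VanishesAt G p}}

/-- All singularities of the surface `F = 0` are isolated: every singular point has a
Zariski neighbourhood (hence also one in the finer classical topology) that contains no
other singular point. -/
def HasOnlyIsolatedSingularities (F : Poly4) : Prop :=
  ∀ p ∈ singularPoints F, ∃ U : Set P3, @IsOpen P3 zariski U ∧ U ∩ singularPoints F = {p}

/-- The point set of the surface `F = 0` is irreducible in the Zariski topology. -/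
def IsIrreducibleSurface (F : Poly4) : Prop := @IsIrreducible P3 zariski (surface F)

/-- The surface `F = 0`, as a scheme, is reduced: the ideal generated by `F` is radical. -/
def IsReducedSurface (F : Poly4) : Prop := (Ideal.span {F}).IsRadical

end

/-!
On the quadric `Q = 0`, identified with `ℙ₁ × ℙ₁` by the Segre embedding `segrePoint u v`, the form
`Sₙ` restricts to a constant times `f u * f v`, where `f` is the binary form of degree `n` that
vanishes at the vertices of the octahedron, the cube or the icosahedron. Up to a multiple of
`Q ^ (n / 2)` the form `Sₙ` is harmonic, which forces its whole gradient along the quadric to be a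
constant times the tensor product `∇f u ⊗ ∇f v`. This is verified by expanding both sides
(`eq_zero_of_tensor_gradient`); as `f` has no multiple root, the gradient of `Sₙ` does not vanish
on the quadric. Since `n / 2 ≥ 2`, the gradients of `Sₙ` and `Sₙ + l Q ^ (n / 2)` agree there, so
no member of the pencil with `l ≠ ∞` is singular at a point of the quadric. The other claims follow.

* A projective algebraic set of positive dimension meets the quadric, so there are only finitely
  many singular points. Algebraically: by the Nullstellensatz a power of each variable is congruent to
  a multiple of `Q` modulo the partial derivatives, and therefore the coordinate ring of the
  singular locus on `Q = 1` is spanned by monomials of bounded degree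
  (`finite_of_no_zero_at_infinity`).
* A singular point normalized to `Q = 1` satisfies `l = -Sₙ` and `∇Sₙ = n Sₙ x`. On the affine
  algebraic set given by these conditions `dSₙ = (n / 2) Sₙ dQ = 0`, so `Sₙ` is constant on
  each of its finitely many components (`finite_eval_image_of_kaehlerDifferential_eq_zero`). This
  leaves finitely many parameters.
* The form `f` has a root `u`, so `Sₙ + l Q ^ (n / 2)` vanishes on the line with first parameter
  `u`. If it were a product of two forms of positive degree, one of them would vanish on the line
  and the other one at some point of the line; that point would be a singular point on the quadric
  (`irreducible_of_line`). An irreducible form generates a prime ideal, and with the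
  Nullstellensatz its surface is Zariski irreducible.
-/

/-! ### The invariants in terms of elementary symmetric functions -/

/-- `symSum v e` as the sum over an explicit list of the rearrangements of `e`. -/
theorem symSum_eq_list_sum {R : Type*} [CommSemiring R] (v : Fin 4 → R) (e : Fin 4 → ℕ)
    (l : List (Fin 4 → ℕ)) (hl : l.Nodup := by decide +kernel)
    (h : Finset.univ.image (fun s : Equiv.Perm (Fin 4) => e ∘ s) = l.toFinset := by
      decide +kernel) :
    symSum v e = (l.map fun d => v 0 ^ d 0 * v 1 ^ d 1 * v 2 ^ d 2 * v 3 ^ d 3).sum := by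
  rw [symSum, h, List.sum_toFinset _ hl]
  simp [Fin.prod_univ_four]

/-- The `k`-th elementary symmetric polynomial in four quantities, for `1 ≤ k ≤ 4`; other
indices get the value `0`. -/
def elemSym {R : Type*} [CommRing R] (y : Fin 4 → R) : ℕ → R
  | 1 => y 0 + y 1 + y 2 + y 3
  | 2 => y 0 * y 1 + y 0 * y 2 + y 0 * y 3 + y 1 * y 2 + y 1 * y 3 + y 2 * y 3
  | 3 => y 1 * y 2 * y 3 + y 0 * y 2 * y 3 + y 0 * y 1 * y 3 + y 0 * y 1 * y 2
  | 4 => y 0 * y 1 * y 2 * y 3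
  | _ => 0

/-- The Vandermonde product `∏_{j < i} (yᵢ - yⱼ)` of four quantities. -/
def vandermonde4 {R : Type*} [CommRing R] (y : Fin 4 → R) : R :=
  (y 1 - y 0) * (y 2 - y 0) * (y 2 - y 1) * (y 3 - y 0) * (y 3 - y 1) * (y 3 - y 2)

theorem S6_eq :
    S6 = elemSym (fun i => X i ^ 2) 1 ^ 3
        - 3 * elemSym (fun i => X i ^ 2) 1 * elemSym (fun i => X i ^ 2) 2
        + 18 * elemSym (fun i => X i ^ 2) 3 := by
  rw [S6, symSum_eq_list_sum X ![6, 0, 0, 0] [![6, 0, 0, 0], ![0, 6, 0, 0], ![0, 0, 6, 0],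
      ![0, 0, 0, 6]],
    symSum_eq_list_sum X ![2, 2, 2, 0] [![2, 2, 2, 0], ![2, 2, 0, 2], ![2, 0, 2, 2], ![0, 2, 2, 2]]]
  simp [elemSym, -mul_eq_mul_left_iff]
  ring

theorem S8_eq :
    S8 = elemSym (fun i => X i ^ 2) 1 ^ 4
        - 4 * elemSym (fun i => X i ^ 2) 1 ^ 2 * elemSym (fun i => X i ^ 2) 2
        - 24 * elemSym (fun i => X i ^ 2) 1 * elemSym (fun i => X i ^ 2) 3
        + 16 * elemSym (fun i => X i ^ 2) 2 ^ 2 + 192 * elemSym (fun i => X i ^ 2) 4 := by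
  rw [S8, symSum_eq_list_sum X ![8, 0, 0, 0] [![8, 0, 0, 0], ![0, 8, 0, 0], ![0, 0, 8, 0],
      ![0, 0, 0, 8]],
    symSum_eq_list_sum X ![4, 4, 0, 0] [![4, 4, 0, 0], ![4, 0, 4, 0], ![4, 0, 0, 4],
      ![0, 4, 4, 0], ![0, 4, 0, 4],
      ![0, 0, 4, 4]]]
  simp [elemSym, -mul_eq_mul_left_iff]
  ring

theorem S12symm_eq {R : Type*} [CommRing R] (y : Fin 4 → R) :
    S12symm y =
      2 * elemSym y 1 ^ 4 * elemSym y 2 - 2 * elemSym y 1 ^ 3 * elemSym y 3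
        - 14 * elemSym y 1 ^ 2 * elemSym y 2 ^ 2 + 365 * elemSym y 1 ^ 2 * elemSym y 4
        - 7 * elemSym y 1 * elemSym y 2 * elemSym y 3 + 30 * elemSym y 2 ^ 3
        - 1080 * elemSym y 2 * elemSym y 4 + 21 * elemSym y 3 ^ 2 := by
  rw [S12symm,
    symSum_eq_list_sum y ![5, 1, 0, 0] [![5, 1, 0, 0], ![5, 0, 1, 0], ![5, 0, 0, 1],
      ![1, 5, 0, 0], ![1, 0, 5, 0],
      ![1, 0, 0, 5], ![0, 5, 1, 0], ![0, 5, 0, 1], ![0, 1, 5, 0], ![0, 1, 0, 5], ![0, 0, 5, 1],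
      ![0, 0, 1, 5]],
    symSum_eq_list_sum y ![4, 2, 0, 0] [![4, 2, 0, 0], ![4, 0, 2, 0], ![4, 0, 0, 2],
      ![2, 4, 0, 0], ![2, 0, 4, 0],
      ![2, 0, 0, 4], ![0, 4, 2, 0], ![0, 4, 0, 2], ![0, 2, 4, 0], ![0, 2, 0, 4], ![0, 0, 4, 2],
      ![0, 0, 2, 4]],
    symSum_eq_list_sum y ![4, 1, 1, 0] [![4, 1, 1, 0], ![4, 1, 0, 1], ![4, 0, 1, 1],
      ![1, 4, 1, 0], ![1, 4, 0, 1],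
      ![1, 1, 4, 0], ![1, 1, 0, 4], ![1, 0, 4, 1], ![1, 0, 1, 4], ![0, 4, 1, 1], ![0, 1, 4, 1],
      ![0, 1, 1, 4]],
    symSum_eq_list_sum y ![3, 3, 0, 0] [![3, 3, 0, 0], ![3, 0, 3, 0], ![3, 0, 0, 3],
      ![0, 3, 3, 0], ![0, 3, 0, 3],
      ![0, 0, 3, 3]],
    symSum_eq_list_sum y ![3, 2, 1, 0] [![3, 2, 1, 0], ![3, 2, 0, 1], ![3, 1, 2, 0],
      ![3, 1, 0, 2], ![3, 0, 2, 1],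
      ![3, 0, 1, 2], ![2, 3, 1, 0], ![2, 3, 0, 1], ![2, 1, 3, 0], ![2, 1, 0, 3], ![2, 0, 3, 1],
      ![2, 0, 1, 3],
      ![1, 3, 2, 0], ![1, 3, 0, 2], ![1, 2, 3, 0], ![1, 2, 0, 3], ![1, 0, 3, 2], ![1, 0, 2, 3],
      ![0, 3, 2, 1],
      ![0, 3, 1, 2], ![0, 2, 3, 1], ![0, 2, 1, 3], ![0, 1, 3, 2], ![0, 1, 2, 3]],
    symSum_eq_list_sum y ![3, 1, 1, 1] [![3, 1, 1, 1], ![1, 3, 1, 1], ![1, 1, 3, 1], ![1, 1, 1, 3]],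
    symSum_eq_list_sum y ![2, 2, 2, 0] [![2, 2, 2, 0], ![2, 2, 0, 2], ![2, 0, 2, 2], ![0, 2, 2, 2]],
    symSum_eq_list_sum y ![2, 2, 1, 1] [![2, 2, 1, 1], ![2, 1, 2, 1], ![2, 1, 1, 2],
      ![1, 2, 2, 1], ![1, 2, 1, 2],
      ![1, 1, 2, 2]]]
  simp [elemSym, -mul_eq_mul_left_iff]
  ring

theorem S12anti_eq {R : Type*} [CommRing R] (y : Fin 4 → R) : S12anti y = vandermonde4 y := by
  rw [S12anti, vandermonde4]
  ring

/-! ### The Segre embedding of the quadric -/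

/-- The Segre embedding `(u, v) ↦ u vᵀ` into the `2 × 2` matrices of rank at most one, in the
coordinates in which the determinant becomes a multiple of `∑ xᵢ²`. -/
def segrePoint (u v : Fin 2 → ℂ) : Fin 4 → ℂ :=
  ![u 0 * v 0 + u 1 * v 1, Complex.I * (u 0 * v 0 - u 1 * v 1), u 0 * v 1 - u 1 * v 0,
    Complex.I * (u 0 * v 1 + u 1 * v 0)]

/-- The squares of the coordinates of `segrePoint u v`. -/
def segreSq (u v : Fin 2 → ℂ) : Fin 4 → ℂ :=
  ![(u 0 * v 0 + u 1 * v 1) ^ 2, -(u 0 * v 0 - u 1 * v 1) ^ 2,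
    (u 0 * v 1 - u 1 * v 0) ^ 2, -(u 0 * v 1 + u 1 * v 0) ^ 2]

theorem segrePoint_sq (u v : Fin 2 → ℂ) : (fun j => segrePoint u v j ^ 2) = segreSq u v := by
  funext j
  fin_cases j <;> simp [segrePoint, segreSq, mul_pow]

theorem eval_segrePoint_quadric (u v : Fin 2 → ℂ) : eval (segrePoint u v) quadric = 0 := by
  simp [quadric, Fin.sum_univ_four, segrePoint, mul_pow]
  ring

theorem eq_zero_of_segrePoint_eq_zero {u v : Fin 2 → ℂ} (h : segrePoint u v = 0) :
    u = 0 ∨ v = 0 := by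
  have h0 : u 0 * v 0 + u 1 * v 1 = 0 := congrFun h 0
  have h1 : u 0 * v 0 - u 1 * v 1 = 0 := by simpa [segrePoint] using congrFun h 1
  have h2 : u 0 * v 1 - u 1 * v 0 = 0 := congrFun h 2
  have h3 : u 0 * v 1 + u 1 * v 0 = 0 := by simpa [segrePoint] using congrFun h 3
  have h00 : u 0 * v 0 = 0 := by linear_combination (1 / 2) * (h0 + h1)
  have h01 : u 0 * v 1 = 0 := by linear_combination (1 / 2) * (h2 + h3)
  have h10 : u 1 * v 0 = 0 := by linear_combination (1 / 2) * (h3 - h2)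
  have h11 : u 1 * v 1 = 0 := by linear_combination (1 / 2) * (h0 - h1)
  by_contra! hne
  obtain ⟨a, ha⟩ := Function.ne_iff.mp hne.1
  obtain ⟨b, hb⟩ := Function.ne_iff.mp hne.2
  refine mul_ne_zero ha hb ?_
  fin_cases a <;> fin_cases b <;> assumption

/-- Every point of the quadric lies in the image of the Segre embedding. -/
theorem exists_segrePoint_of_quadric_eq_zero {x : Fin 4 → ℂ} (hx : eval x quadric = 0) :
    ∃ u v : Fin 2 → ℂ, x = segrePoint u v := by
  have hx' : x 0 ^ 2 + x 1 ^ 2 + x 2 ^ 2 + x 3 ^ 2 = 0 := by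
    simpa [quadric, Fin.sum_univ_four] using hx
  have hI : Complex.I ^ 2 = -1 := Complex.I_sq
  obtain ⟨a, b, c, d, h0, h1, h2, h3⟩ : ∃ a b c d : ℂ, x 0 = a + d ∧
      x 1 = Complex.I * (a - d) ∧ x 2 = b - c ∧ x 3 = Complex.I * (b + c) := by
    refine ⟨(x 0 - Complex.I * x 1) / 2, (x 2 - Complex.I * x 3) / 2,
      -(x 2 + Complex.I * x 3) / 2, (x 0 + Complex.I * x 1) / 2, ?_, ?_, ?_, ?_⟩
    · ring
    · linear_combination x 1 * hI
    · ring
    · linear_combination x 3 * hI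
  have hdet : a * d = b * c := by
    rw [h0, h1, h2, h3] at hx'
    linear_combination (1 / 4) * hx' - (1 / 4) * ((a - d) ^ 2 + (b + c) ^ 2) * hI
  suffices ∃ u v : Fin 2 → ℂ, a = u 0 * v 0 ∧ b = u 0 * v 1 ∧ c = u 1 * v 0 ∧ d = u 1 * v 1 by
    obtain ⟨u, v, rfl, rfl, rfl, rfl⟩ := this
    refine ⟨u, v, funext fun j => ?_⟩
    fin_cases j
    · exact h0
    · exact h1
    · exact h2
    · exact h3
  by_cases ha : a = 0
  · obtain hb | hc := mul_eq_zero.mp (hdet.symm.trans (by rw [ha, zero_mul]))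
    · exact ⟨![0, 1], ![c, d], by simp [ha, hb]⟩
    · exact ⟨![b, d], ![0, 1], by simp [ha, hc]⟩
  · refine ⟨![1, c / a], ![a, b], ?_⟩
    have : d = c / a * b := by field_simp; linear_combination hdet
    simp [this, ha]

/-! ### Gradients of the invariants along the quadric -/

/-- The partial derivative `∂ eₖ / ∂ yᵢ` of an elementary symmetric polynomial, for `1 ≤ k ≤ 4`,
obtained from the recursion `∂ᵢ eₖ = eₖ₋₁ - yᵢ ∂ᵢ eₖ₋₁`. -/
def elemSymDeriv {R : Type*} [CommRing R] (y : Fin 4 → R) (i : Fin 4) : ℕ → R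
  | 1 => 1
  | 2 => elemSym y 1 - y i
  | 3 => elemSym y 2 - y i * elemSym y 1 + y i ^ 2
  | 4 => elemSym y 3 - y i * elemSym y 2 + y i ^ 2 * elemSym y 1 - y i ^ 3
  | _ => 0

/-- The partial derivatives of `vandermonde4`. -/
def vandermondeDeriv {R : Type*} [CommRing R] (y : Fin 4 → R) : Fin 4 → R :=
  ![-((y 2 - y 0) * (y 3 - y 0) + (y 1 - y 0) * (y 3 - y 0) + (y 1 - y 0) * (y 2 - y 0)) *
      ((y 2 - y 1) * (y 3 - y 1) * (y 3 - y 2)),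
    ((y 2 - y 1) * (y 3 - y 1) + (y 0 - y 1) * (y 3 - y 1) + (y 0 - y 1) * (y 2 - y 1)) *
      ((y 2 - y 0) * (y 3 - y 0) * (y 3 - y 2)),
    -((y 1 - y 2) * (y 3 - y 2) + (y 0 - y 2) * (y 3 - y 2) + (y 0 - y 2) * (y 1 - y 2)) *
      ((y 1 - y 0) * (y 3 - y 0) * (y 3 - y 1)),
    ((y 1 - y 3) * (y 2 - y 3) + (y 0 - y 3) * (y 2 - y 3) + (y 0 - y 3) * (y 1 - y 3)) *
      ((y 1 - y 0) * (y 2 - y 0) * (y 2 - y 1))]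

theorem pderiv_elemSym (i : Fin 4) {k : ℕ} (hk : k ∈ Finset.Icc 1 4) :
    pderiv i (elemSym (fun j => (X j ^ 2 : Poly4)) k) =
      2 * X i * elemSymDeriv (fun j => X j ^ 2) i k := by
  fin_cases hk <;> fin_cases i <;>
    simp [elemSym, elemSymDeriv, Derivation.leibniz, Derivation.leibniz_pow, pderiv_X] <;> ring

theorem pderiv_vandermonde4 (i : Fin 4) :
    pderiv i (vandermonde4 (fun j => (X j ^ 2 : Poly4))) =
      2 * X i * vandermondeDeriv (fun j => X j ^ 2) i := by
  fin_cases i <;>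
    simp [vandermonde4, vandermondeDeriv, Derivation.leibniz, Derivation.leibniz_pow,
      pderiv_X] <;> ring

theorem eval_elemSym (x : Fin 4 → ℂ) (k : ℕ) :
    eval x (elemSym (fun j => (X j ^ 2 : Poly4)) k) = elemSym (fun j => x j ^ 2) k := by
  unfold elemSym
  split <;> simp

theorem eval_vandermondeDeriv (x : Fin 4 → ℂ) (i : Fin 4) :
    eval x (vandermondeDeriv (fun j => (X j ^ 2 : Poly4)) i) =
      vandermondeDeriv (fun j => x j ^ 2) i := by
  fin_cases i <;> simp [vandermondeDeriv]

theorem pderiv_ofNat (i : Fin 4) (n : ℕ) [n.AtLeastTwo] :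
    pderiv i (ofNat(n) : Poly4) = 0 :=
  (pderiv i).map_natCast n

theorem elemSym_one_eq_zero {x : Fin 4 → ℂ} (hx : eval x quadric = 0) :
    elemSym (fun j => x j ^ 2) 1 = 0 := by
  simpa [quadric, Fin.sum_univ_four, elemSym] using hx

/-- The gradient of `S₆` along the quadric; the terms divisible by `e₁² = Q²` do not contribute. -/
theorem eval_pderiv_S6 {x : Fin 4 → ℂ} (hx : eval x quadric = 0) (i : Fin 4) :
    eval x (pderiv i S6) = 6 * (x i *
      (5 * elemSym (fun j => x j ^ 2) 2 + 6 * (x i ^ 2) ^ 2)) := by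
  rw [S6_eq]
  simp [Derivation.leibniz, Derivation.leibniz_pow, pderiv_elemSym, pderiv_ofNat, eval_elemSym,
    elemSym_one_eq_zero hx, elemSymDeriv]
  ring

theorem eval_pderiv_S8 {x : Fin 4 → ℂ} (hx : eval x quadric = 0) (i : Fin 4) :
    eval x (pderiv i S8) = 16 * (x i *
      (21 * elemSym (fun j => x j ^ 2) 3 - 28 * elemSym (fun j => x j ^ 2) 2 * x i ^ 2
        - 24 * (x i ^ 2) ^ 3)) := by
  rw [S8_eq]
  simp [Derivation.leibniz, Derivation.leibniz_pow, pderiv_elemSym, pderiv_ofNat, eval_elemSym,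
    elemSym_one_eq_zero hx, elemSymDeriv]
  ring

theorem eval_pderiv_S12 {x : Fin 4 → ℂ} (hx : eval x quadric = 0) (i : Fin 4) :
    eval x (pderiv i S12) = 2 * (x i *
      (990 * elemSym (fun j => x j ^ 2) 2 ^ 2 * x i ^ 2
        + 1080 * elemSym (fun j => x j ^ 2) 4 * x i ^ 2
        + 42 * elemSym (fun j => x j ^ 2) 3 * (x i ^ 2) ^ 2
        - 1045 * elemSym (fun j => x j ^ 2) 2 * elemSym (fun j => x j ^ 2) 3
        + 1080 * elemSym (fun j => x j ^ 2) 2 * (x i ^ 2) ^ 3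
        + 33 * (Real.sqrt 5 : ℝ) * vandermondeDeriv (fun j => x j ^ 2) i)) := by
  rw [S12, S12symm_eq, S12anti_eq]
  simp [Derivation.leibniz, Derivation.leibniz_pow, pderiv_elemSym, pderiv_vandermonde4,
    pderiv_ofNat, eval_elemSym, eval_vandermondeDeriv,
    elemSym_one_eq_zero hx, elemSymDeriv]
  ring

/-- A gradient of the form `(xᵢ Tᵢ(x₀², …, x₃²))ᵢ` which, in Segre coordinates on the quadric,
becomes a multiple of the tensor product `k u ⊗ k v`, vanishes at a point of the quadric only if
`k` vanishes at one of the two parameters. -/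
theorem eq_zero_of_tensor_gradient {k : (Fin 2 → ℂ) → Fin 2 → ℂ}
    (hk : ∀ u, k u 0 = 0 → k u 1 = 0 → u = 0)
    (T : (Fin 4 → ℂ) → Fin 4 → ℂ) {c : ℂ} (hc : c ≠ 0)
    (h00 : ∀ u v, c * (k u 0 * k v 0) =
      (u 0 * v 0 + u 1 * v 1) * T (segreSq u v) 0 - (u 0 * v 0 - u 1 * v 1) * T (segreSq u v) 1)
    (h11 : ∀ u v, c * (k u 1 * k v 1) =
      (u 0 * v 0 + u 1 * v 1) * T (segreSq u v) 0 + (u 0 * v 0 - u 1 * v 1) * T (segreSq u v) 1)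
    (h01 : ∀ u v, c * (k u 0 * k v 1) =
      (u 0 * v 1 - u 1 * v 0) * T (segreSq u v) 2 - (u 0 * v 1 + u 1 * v 0) * T (segreSq u v) 3)
    (h10 : ∀ u v, c * (k u 1 * k v 0) =
      -(u 0 * v 1 - u 1 * v 0) * T (segreSq u v) 2 - (u 0 * v 1 + u 1 * v 0) * T (segreSq u v) 3)
    {x : Fin 4 → ℂ} (hx : eval x quadric = 0)
    (h : ∀ i, x i * T (fun j => x j ^ 2) i = 0) : x = 0 := by
  obtain ⟨u, v, rfl⟩ := exists_segrePoint_of_quadric_eq_zero hx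
  rw [segrePoint_sq] at h
  have t0 : (u 0 * v 0 + u 1 * v 1) * T (segreSq u v) 0 = 0 := h 0
  have t1 : (u 0 * v 0 - u 1 * v 1) * T (segreSq u v) 1 = 0 :=
    (mul_eq_zero_iff_left Complex.I_ne_zero).mp ((mul_assoc _ _ _).symm.trans (h 1))
  have t2 : (u 0 * v 1 - u 1 * v 0) * T (segreSq u v) 2 = 0 := h 2
  have t3 : (u 0 * v 1 + u 1 * v 0) * T (segreSq u v) 3 = 0 :=
    (mul_eq_zero_iff_left Complex.I_ne_zero).mp ((mul_assoc _ _ _).symm.trans (h 3))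
  have g00 : k u 0 * k v 0 = 0 := by
    simpa [t0, t1, hc] using h00 u v
  have g11 : k u 1 * k v 1 = 0 := by
    simpa [t0, t1, hc] using h11 u v
  have g01 : k u 0 * k v 1 = 0 := by
    simpa [t2, t3, hc] using h01 u v
  have g10 : k u 1 * k v 0 = 0 := by
    have := h10 u v
    rw [neg_mul, t2, t3] at this
    simpa [hc] using this
  have huv : u = 0 ∨ v = 0 := by
    by_cases hu : k u 0 = 0
    · by_cases hu' : k u 1 = 0
      · exact Or.inl (hk u hu hu')
      · exact Or.inr (hk v (by simpa [hu'] using g10) (by simpa [hu'] using g11))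
    · exact Or.inr (hk v (by simpa [hu] using g00) (by simpa [hu] using g01))
  funext j
  obtain rfl | rfl := huv <;> fin_cases j <;> simp [segrePoint]

theorem eq_zero_of_S6_gradient_eq_zero {x : Fin 4 → ℂ} (hx : eval x quadric = 0)
    (h : ∀ i, eval x (pderiv i S6) = 0) : x = 0 := by
  refine eq_zero_of_tensor_gradient (c := 2)
    (k := fun u => ![5 * u 0 ^ 4 * u 1 - u 1 ^ 5, u 0 ^ 5 - 5 * u 0 * u 1 ^ 4]) (fun u h0 h1 => ?_)
    (fun y i => 5 * elemSym y 2 + 6 * y i ^ 2) (by norm_num) ?_ ?_ ?_ ?_ hx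
    (fun i => by simpa [eval_pderiv_S6 hx] using h i)
  · simp only [Matrix.cons_val] at h0 h1
    have e0 : u 0 ^ 9 = 0 := by
      linear_combination u 0 ^ 4 * h1 + 5 / 24 * (5 * u 0 * u 1 ^ 3 * h0 - u 1 ^ 4 * h1)
    have e1 : u 1 ^ 9 = 0 := by
      linear_combination -u 1 ^ 4 * h0 + 5 / 24 * (u 0 ^ 4 * h0 - 5 * u 0 ^ 3 * u 1 * h1)
    funext j
    fin_cases j
    · simpa using e0
    · simpa using e1
  all_goals
    intro u v
    simp only [elemSym, segreSq, Matrix.cons_val]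
    ring

theorem eq_zero_of_S8_gradient_eq_zero {x : Fin 4 → ℂ} (hx : eval x quadric = 0)
    (h : ∀ i, eval x (pderiv i S8) = 0) : x = 0 := by
  refine eq_zero_of_tensor_gradient (c := 8)
    (k := fun u => ![u 0 ^ 7 + 7 * u 0 ^ 3 * u 1 ^ 4, u 1 ^ 7 + 7 * u 0 ^ 4 * u 1 ^ 3])
    (fun u h0 h1 => ?_)
    (fun y i => 21 * elemSym y 3 - 28 * elemSym y 2 * y i - 24 * y i ^ 3)
    (by norm_num) ?_ ?_ ?_ ?_ hx (fun i => by simpa [eval_pderiv_S8 hx] using h i)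
  · simp only [Matrix.cons_val] at h0 h1
    have e0 : u 0 ^ 11 = 0 := by
      linear_combination u 0 ^ 4 * h0 - 7 / 48 * (7 * u 0 ^ 3 * u 1 * h1 - u 1 ^ 4 * h0)
    have e1 : u 1 ^ 11 = 0 := by
      linear_combination u 1 ^ 4 * h1 - 7 / 48 * (7 * u 0 * u 1 ^ 3 * h0 - u 0 ^ 4 * h1)
    funext j
    fin_cases j
    · simpa using e0
    · simpa using e1
  all_goals
    intro u v
    simp only [elemSym, segreSq, Matrix.cons_val]
    ring

/-- One of the two partial derivatives of the icosahedral form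
`5 (u¹² + v¹²) - 22 s (u¹⁰ v² + u² v¹⁰) - 165 (u⁸ v⁴ + u⁴ v⁸) + 44 s u⁶ v⁶`, where `s² = 5`; the
other one is obtained by exchanging the variables. -/
def icosaDeriv (s a b : ℂ) : ℂ :=
  60 * a ^ 11 - 22 * s * (10 * a ^ 9 * b ^ 2 + 2 * a * b ^ 10)
    - 165 * (8 * a ^ 7 * b ^ 4 + 4 * a ^ 3 * b ^ 8) + 264 * s * a ^ 5 * b ^ 6

/-- The icosahedral form has no multiple root. -/
theorem icosaDeriv_eq_zero {s a b : ℂ} (hs : s ^ 2 = 5) (h0 : icosaDeriv s a b = 0)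
    (h1 : icosaDeriv s b a = 0) : a = 0 ∧ b = 0 := by
  rw [icosaDeriv] at h0 h1
  have hab : a ^ 19 * b = 0 := by
    -- The Bézout identity behind the nonvanishing of the resultant of the two derivatives.
    linear_combination
      b * (34681 / 3932160 * a ^ 8 - 1243 / 393216 * s * a ^ 6 * b ^ 2
        + 3047 / 196608 * a ^ 4 * b ^ 4 + 5159 / 1966080 * s * a ^ 2 * b ^ 6
        - 187 / 262144 * b ^ 8) * h0
      + a * (-561 / 262144 * s * a ^ 8 - 6413 / 393216 * a ^ 6 * b ^ 2
        + 1573 / 491520 * s * a ^ 4 * b ^ 4 - 15367 / 1966080 * a ^ 2 * b ^ 6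
        - 2057 / 3932160 * s * b ^ 8) * h1
      + (121 / 327680 * a ^ 3 * b ^ 17 + 847 / 81920 * a ^ 7 * b ^ 13
        + 11979 / 163840 * a ^ 11 * b ^ 9 + 847 / 81920 * a ^ 15 * b ^ 5
        - 6171 / 65536 * a ^ 19 * b) * hs
  obtain h | rfl := mul_eq_zero.mp hab
  · obtain rfl : a = 0 := by simpa using h
    simpa using h1
  · simpa using h0

theorem sqrt_five_sq : ((Real.sqrt 5 : ℝ) : ℂ) ^ 2 = 5 := by
  rw [← Complex.ofReal_pow, Real.sq_sqrt (by norm_num)]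
  norm_num

theorem eq_zero_of_S12_gradient_eq_zero {x : Fin 4 → ℂ} (hx : eval x quadric = 0)
    (h : ∀ i, eval x (pderiv i S12) = 0) : x = 0 := by
  have hs := sqrt_five_sq
  refine eq_zero_of_tensor_gradient (c := -1 / 20)
    (k := fun u => ![icosaDeriv (Real.sqrt 5 : ℝ) (u 0) (u 1),
      icosaDeriv (Real.sqrt 5 : ℝ) (u 1) (u 0)]) (fun u h0 h1 => ?_)
    (fun y i => 990 * elemSym y 2 ^ 2 * y i + 1080 * elemSym y 4 * y i
        + 42 * elemSym y 3 * y i ^ 2 - 1045 * elemSym y 2 * elemSym y 3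
        + 1080 * elemSym y 2 * y i ^ 3
        + 33 * (Real.sqrt 5 : ℝ) * vandermondeDeriv y i)
    (by norm_num) ?_ ?_ ?_ ?_ hx (fun i => (mul_eq_zero_iff_left two_ne_zero).mp
      ((eval_pderiv_S12 hx i).symm.trans (h i)))
  · obtain ⟨e0, e1⟩ := icosaDeriv_eq_zero hs h0 h1
    funext j
    fin_cases j
    · exact e0
    · exact e1
  all_goals generalize ((Real.sqrt 5 : ℝ) : ℂ) = s at hs
  · intro u v
    simp only [icosaDeriv, elemSym, segreSq, vandermondeDeriv, Matrix.cons_val]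
    linear_combination (-1 / 20 * (264 * u 0 ^ 5 * u 1 ^ 6
        - 22 * (10 * u 0 ^ 9 * u 1 ^ 2 + 2 * u 0 * u 1 ^ 10)) *
      (264 * v 0 ^ 5 * v 1 ^ 6 - 22 * (10 * v 0 ^ 9 * v 1 ^ 2 + 2 * v 0 * v 1 ^ 10))) * hs
  · intro u v
    simp only [icosaDeriv, elemSym, segreSq, vandermondeDeriv, Matrix.cons_val]
    linear_combination (-1 / 20 * (264 * u 1 ^ 5 * u 0 ^ 6
        - 22 * (10 * u 1 ^ 9 * u 0 ^ 2 + 2 * u 1 * u 0 ^ 10)) *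
      (264 * v 1 ^ 5 * v 0 ^ 6 - 22 * (10 * v 1 ^ 9 * v 0 ^ 2 + 2 * v 1 * v 0 ^ 10))) * hs
  · intro u v
    simp only [icosaDeriv, elemSym, segreSq, vandermondeDeriv, Matrix.cons_val]
    linear_combination (-1 / 20 * (264 * u 0 ^ 5 * u 1 ^ 6
        - 22 * (10 * u 0 ^ 9 * u 1 ^ 2 + 2 * u 0 * u 1 ^ 10)) *
      (264 * v 1 ^ 5 * v 0 ^ 6 - 22 * (10 * v 1 ^ 9 * v 0 ^ 2 + 2 * v 1 * v 0 ^ 10))) * hs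
  · intro u v
    simp only [icosaDeriv, elemSym, segreSq, vandermondeDeriv, Matrix.cons_val]
    linear_combination (-1 / 20 * (264 * u 1 ^ 5 * u 0 ^ 6
        - 22 * (10 * u 1 ^ 9 * u 0 ^ 2 + 2 * u 1 * u 0 ^ 10)) *
      (264 * v 0 ^ 5 * v 1 ^ 6 - 22 * (10 * v 0 ^ 9 * v 1 ^ 2 + 2 * v 0 * v 1 ^ 10))) * hs

/-! ### Functions with vanishing differential -/

open TensorProduct in
/-- In characteristic zero an element of a finitely generated field extension with vanishing
differential is algebraic: over the rational function field in a transcendental element `x` the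
extension is formally smooth, so that `dx` stays nonzero. -/
theorem isAlgebraic_of_kaehlerDifferential_eq_zero {K L : Type} [Field K] [CharZero K] [Field L]
    [Algebra K L] [Algebra.EssFiniteType K L] {x : L} (hx : KaehlerDifferential.D K L x = 0) :
    IsAlgebraic K x := by
  by_contra htr
  have hinj : Function.Injective (Polynomial.aeval (R := K) x) :=
    transcendental_iff_injective.mp htr
  let _ : Algebra (Polynomial K) L := (Polynomial.aeval (R := K) x).toAlgebra
  have hmap : ∀ p : Polynomial K, algebraMap (Polynomial K) L p = Polynomial.aeval x p :=
    fun p => rfl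
  have : IsScalarTower K (Polynomial K) L := IsScalarTower.of_algebraMap_eq fun c => by
    rw [hmap, Polynomial.algebraMap_eq, Polynomial.aeval_C]
  have : FaithfulSMul (Polynomial K) L := (faithfulSMul_iff_algebraMap_injective _ _).mpr hinj
  let _ : Algebra (FractionRing (Polynomial K)) L := FractionRing.liftAlgebra (Polynomial K) L
  have : IsScalarTower (Polynomial K) (FractionRing (Polynomial K)) L := inferInstance
  have : IsScalarTower K (FractionRing (Polynomial K)) L :=
    IsScalarTower.to₁₃₄ K (Polynomial K) (FractionRing (Polynomial K)) L
  have : Algebra.EssFiniteType (FractionRing (Polynomial K)) L :=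
    Algebra.EssFiniteType.of_comp K _ _
  have : CharZero (FractionRing (Polynomial K)) := inferInstance
  have : Algebra.FormallySmooth (FractionRing (Polynomial K)) L := inferInstance
  have : Algebra.FormallyEtale (Polynomial K) (FractionRing (Polynomial K)) :=
    Algebra.FormallyEtale.of_isLocalization (nonZeroDivisors _)
  have : Algebra.FormallySmooth (Polynomial K) L :=
    Algebra.FormallySmooth.comp _ (FractionRing (Polynomial K)) _
  have hker : (1 : L) ⊗ₜ[Polynomial K] KaehlerDifferential.D K (Polynomial K) Polynomial.X = 0 := by
    have hmapx : KaehlerDifferential.mapBaseChange K (Polynomial K) L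
        (1 ⊗ₜ KaehlerDifferential.D K (Polynomial K) Polynomial.X) = 0 := by
      rw [KaehlerDifferential.mapBaseChange_tmul, one_smul, KaehlerDifferential.map_D, hmap,
        Polynomial.aeval_X, hx]
    obtain ⟨z, hz⟩ := (Algebra.H1Cotangent.exact_δ_mapBaseChange K (Polynomial K) L _).mp hmapx
    rw [← hz, Subsingleton.elim z 0, map_zero]
  have h1 := congrArg (fun t => TensorProduct.rid (Polynomial K) L
    (TensorProduct.map LinearMap.id (KaehlerDifferential.polynomialEquiv K).toLinearMap t)) hker
  simp [KaehlerDifferential.polynomialEquiv_D] at h1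

/-- A function whose differential vanishes on an affine algebraic set takes only finitely many
values there: it is constant on each irreducible component. -/
theorem finite_eval_image_of_kaehlerDifferential_eq_zero {σ : Type} [Finite σ]
    (I : Ideal (MvPolynomial σ ℂ)) (S : MvPolynomial σ ℂ)
    (h : KaehlerDifferential.D ℂ (MvPolynomial σ ℂ ⧸ I) (Ideal.Quotient.mk I S) = 0) :
    ((fun x => eval x S) '' {x | ∀ p ∈ I, eval x p = 0}).Finite := by
  have key : ∀ P ∈ I.minimalPrimes, ∃ c : ℂ, S - C c ∈ P := by
    intro P hP
    have : P.IsPrime := hP.1.1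
    have hIP : I ≤ P := hP.1.2
    let A := MvPolynomial σ ℂ ⧸ P
    let L := FractionRing A
    have : Algebra.EssFiniteType ℂ L := Algebra.EssFiniteType.comp ℂ A L
    have hD : KaehlerDifferential.D ℂ L (algebraMap A L (Ideal.Quotient.mk P S)) = 0 := by
      let φ : (MvPolynomial σ ℂ ⧸ I) →ₐ[ℂ] L :=
        (IsScalarTower.toAlgHom ℂ A L).comp (Ideal.Quotient.factorₐ ℂ hIP)
      let _ := φ.toRingHom.toAlgebra
      have : IsScalarTower ℂ (MvPolynomial σ ℂ ⧸ I) L := IsScalarTower.of_algHom φ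
      have := KaehlerDifferential.map_D ℂ ℂ (MvPolynomial σ ℂ ⧸ I) L (Ideal.Quotient.mk I S)
      rw [h, map_zero] at this
      exact this.symm
    have hint := (isAlgebraic_of_kaehlerDifferential_eq_zero hD).isIntegral
    obtain ⟨c, hc⟩ := minpoly.mem_range_of_degree_eq_one ℂ _
      (IsAlgClosed.degree_eq_one_of_irreducible ℂ (minpoly.irreducible hint))
    refine ⟨c, Ideal.Quotient.eq.mp (IsFractionRing.injective A L ?_)⟩
    rw [← hc, IsScalarTower.algebraMap_apply ℂ A L]
    rfl
  choose! c hc using key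
  refine ((Ideal.finite_minimalPrimes_of_isNoetherianRing _ I).image c).subset ?_
  rintro _ ⟨x, hx, rfl⟩
  have hle : I ≤ RingHom.ker (eval x) := fun p hp => hx p hp
  have : (RingHom.ker (eval x)).IsPrime := RingHom.ker_isPrime _
  obtain ⟨P, hP, hPx⟩ := Ideal.exists_minimalPrimes_le hle
  refine ⟨P, hP, ?_⟩
  have : eval x (S - C (c P)) = 0 := hPx (hc P hP)
  exact (sub_eq_zero.mp (by simpa using this)).symm

/-! ### Forms, their factors and their zeros -/

theorem homogeneousComponent_mul_of_isHomogeneous {σ R : Type*} [CommRing R]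
    {p q : MvPolynomial σ R} {d n : ℕ} (hq : q.IsHomogeneous d) (h : d ≤ n) :
    homogeneousComponent n (p * q) = homogeneousComponent (n - d) p * q := by
  have key : ∀ i, homogeneousComponent n (homogeneousComponent i p * q) =
      if n = i + d then homogeneousComponent i p * q else 0 := fun i =>
    homogeneousComponent_of_mem ((homogeneousComponent_isHomogeneous i p).mul hq)
  calc homogeneousComponent n (p * q)
      = homogeneousComponent n
          ((∑ i ∈ Finset.range (p.totalDegree + 1), homogeneousComponent i p) * q) := by
        rw [sum_homogeneousComponent]
    _ = ∑ i ∈ Finset.range (p.totalDegree + 1),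
          if n = i + d then homogeneousComponent i p * q else 0 := by
        rw [Finset.sum_mul, map_sum]
        exact Finset.sum_congr rfl fun i _ => key i
    _ = homogeneousComponent (n - d) p * q := by
        rw [Finset.sum_eq_single (n - d)]
        · rw [if_pos (by omega)]
        · intro i _ hi
          rw [if_neg (by omega)]
        · intro hi
          rw [Finset.mem_range] at hi
          rw [homogeneousComponent_eq_zero _ _ (by omega), zero_mul, ite_self]

/-- A factorization of a form can be replaced by the factorization into leading forms. -/
theorem eq_homogeneousComponent_mul {σ R : Type*} [CommRing R] [IsDomain R]
    {p q : MvPolynomial σ R} {n : ℕ} (h : (p * q).IsHomogeneous n) (h0 : p * q ≠ 0) :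
    p * q = homogeneousComponent p.totalDegree p * homogeneousComponent q.totalDegree q := by
  have hn : n = p.totalDegree + q.totalDegree := by
    rw [← totalDegree_mul_of_isDomain (left_ne_zero_of_mul h0) (right_ne_zero_of_mul h0),
      h.totalDegree h0]
  have key : ∀ i j, homogeneousComponent n (homogeneousComponent i p * homogeneousComponent j q) =
      if n = i + j then homogeneousComponent i p * homogeneousComponent j q else 0 := fun i j =>
    homogeneousComponent_of_mem
      ((homogeneousComponent_isHomogeneous i p).mul (homogeneousComponent_isHomogeneous j q))
  calc p * q = homogeneousComponent n (p * q) := (homogeneousComponent_eq_self h).symm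
    _ = homogeneousComponent n
          ((∑ i ∈ Finset.range (p.totalDegree + 1), homogeneousComponent i p) *
            ∑ j ∈ Finset.range (q.totalDegree + 1), homogeneousComponent j q) := by
        rw [sum_homogeneousComponent, sum_homogeneousComponent]
    _ = ∑ i ∈ Finset.range (p.totalDegree + 1), ∑ j ∈ Finset.range (q.totalDegree + 1),
          if n = i + j then homogeneousComponent i p * homogeneousComponent j q else 0 := by
        rw [Finset.sum_mul_sum, map_sum]
        refine Finset.sum_congr rfl fun i _ => ?_
        rw [map_sum]
        exact Finset.sum_congr rfl fun j _ => key i j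
    _ = _ := by
        rw [Finset.sum_eq_single p.totalDegree, Finset.sum_eq_single q.totalDegree, if_pos hn]
        · intro j _ hjq
          rw [if_neg (by omega)]
        · simp
        · intro i hi hip
          refine Finset.sum_eq_zero fun j hj => if_neg ?_
          rw [Finset.mem_range] at hi hj
          omega
        · simp

theorem eval_smul_of_isHomogeneous {σ : Type*} {G : MvPolynomial σ ℂ} {d : ℕ}
    (hG : G.IsHomogeneous d) (a : ℂ) (x : σ → ℂ) : eval (a • x) G = a ^ d * eval x G := by
  rw [eval_eq, eval_eq, Finset.mul_sum]
  refine Finset.sum_congr rfl fun m hm => ?_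
  rw [hG.degree_eq_sum_deg_support hm, ← Finset.prod_pow_eq_pow_sum]
  simp only [Pi.smul_apply, smul_eq_mul, mul_pow, Finset.prod_mul_distrib]
  ring

theorem eval_aeval_polynomial {σ : Type*} (f : σ → Polynomial ℂ) (t : ℂ) (G : MvPolynomial σ ℂ) :
    (aeval f G).eval t = eval (fun i => (f i).eval t) G := by
  have : ((Polynomial.aeval t).comp (aeval f) : MvPolynomial σ ℂ →ₐ[ℂ] ℂ) =
      aeval fun i => (f i).eval t := by
    ext i
    simp
  exact congrArg (fun φ => φ G) this

/-- A binary form of positive degree has a nontrivial zero. -/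
theorem exists_ne_zero_eval_eq_zero {G : MvPolynomial (Fin 2) ℂ} {d : ℕ} (hG : G.IsHomogeneous d)
    (hd : d ≠ 0) : ∃ v : Fin 2 → ℂ, v ≠ 0 ∧ eval v G = 0 := by
  by_contra! hne
  -- `G(t, 1)` has no root, so it is constant, and `G(1, s)` agrees with a multiple of `s ^ d`.
  let g : Polynomial ℂ := aeval ![Polynomial.X, 1] G
  let h : Polynomial ℂ := aeval ![1, Polynomial.X] G
  have hg : ∀ t, g.eval t = eval ![t, 1] G := by
    intro t
    rw [eval_aeval_polynomial]
    congr 2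
    funext i
    fin_cases i <;> simp
  have hh : ∀ s, h.eval s = eval ![1, s] G := by
    intro s
    rw [eval_aeval_polynomial]
    congr 2
    funext i
    fin_cases i <;> simp
  have hdeg : g.degree = 0 := by
    by_contra hdeg
    obtain ⟨t, ht⟩ := IsAlgClosed.exists_root g hdeg
    refine hne ![t, 1] (fun h0 => one_ne_zero (congrFun h0 1)) ?_
    rw [← hg]
    exact ht
  obtain ⟨c, hc⟩ : ∃ c, g = Polynomial.C c := ⟨_, Polynomial.eq_C_of_degree_eq_zero hdeg⟩
  have heq : h = Polynomial.C c * Polynomial.X ^ d := by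
    refine Polynomial.eq_of_infinite_eval_eq _ _ ((Set.finite_singleton 0).infinite_compl.mono ?_)
    intro s hs
    have hs0 : s ≠ 0 := hs
    have : (![1, s] : Fin 2 → ℂ) = s • ![s⁻¹, 1] := by simp [hs0]
    rw [Set.mem_ofPred_eq, hh, this, eval_smul_of_isHomogeneous hG, ← hg, hc]
    simp only [Polynomial.eval_C, Polynomial.eval_mul, Polynomial.eval_pow, Polynomial.eval_X]
    ring
  refine hne ![1, 0] (fun h0 => one_ne_zero (congrFun h0 0)) ?_
  rw [← hh, heq]
  simp [hd]

/-- An affine algebraic set on which a high power of each coordinate agrees with a polynomial of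
lower degree is finite, because its coordinate ring is spanned by monomials of bounded degree. -/
theorem finite_of_pow_sub_mem {σ : Type} [Fintype σ] (I : Ideal (MvPolynomial σ ℂ)) {N : ℕ}
    (b : σ → MvPolynomial σ ℂ) (hb : ∀ i, (b i).totalDegree < N)
    (h : ∀ i, X i ^ N - b i ∈ I) : {x | ∀ p ∈ I, eval x p = 0}.Finite := by
  classical
  let A := MvPolynomial σ ℂ ⧸ I
  let D := Fintype.card σ * N
  let M : Submodule ℂ A := Submodule.span ℂ
    ((fun m : σ →₀ ℕ => (Ideal.Quotient.mk I (monomial m 1) : A)) '' {m | m.degree ≤ D})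
  have hmem : ∀ d, ∀ p : MvPolynomial σ ℂ, p.totalDegree ≤ d → Ideal.Quotient.mkₐ ℂ I p ∈ M := by
    intro d
    induction d using Nat.strong_induction_on with
    | _ d ih =>
    intro p hp
    rw [p.as_sum, map_sum]
    refine Submodule.sum_mem _ fun m hm => ?_
    have hmd : m.degree ≤ d := by
      refine le_trans ?_ hp
      simpa [Finsupp.degree_apply, Finsupp.sum] using le_totalDegree hm
    have hsmul : monomial m (coeff m p) = coeff m p • monomial m (1 : ℂ) := by
      rw [smul_monomial, smul_eq_mul, mul_one]
    rw [hsmul, map_smul]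
    refine Submodule.smul_mem _ _ ?_
    by_cases hmD : m.degree ≤ D
    · exact Submodule.subset_span ⟨m, hmD, rfl⟩
    -- Some exponent is at least `N`, and the relation for that variable lowers the degree.
    obtain ⟨i, hi⟩ : ∃ i, N ≤ m i := by
      by_contra! hlt
      apply hmD
      rw [Finsupp.degree_eq_sum]
      calc ∑ i, m i ≤ ∑ _i : σ, N := Finset.sum_le_sum fun i _ => (hlt i).le
        _ = D := by simp [D]
    obtain ⟨m', rfl⟩ : ∃ m', m = Finsupp.single i N + m' :=
      ⟨m - Finsupp.single i N, (add_tsub_cancel_of_le (Finsupp.single_le_iff.mpr hi)).symm⟩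
    have hdeg : N + m'.degree ≤ d := by simpa using hmd
    have hrel : Ideal.Quotient.mkₐ ℂ I (monomial (Finsupp.single i N + m') 1) =
        Ideal.Quotient.mkₐ ℂ I (b i * monomial m' 1) := by
      refine Ideal.Quotient.eq.mpr ?_
      have : monomial (Finsupp.single i N + m') (1 : ℂ) = X i ^ N * monomial m' 1 := by
        rw [X_pow_eq_monomial, monomial_mul, one_mul]
      rw [this, ← sub_mul]
      exact I.mul_mem_right _ (h i)
    rw [hrel]
    have hlt : (b i * monomial m' (1 : ℂ)).totalDegree < d := by
      refine lt_of_le_of_lt (totalDegree_mul _ _) ?_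
      have : (monomial m' (1 : ℂ)).totalDegree = m'.degree := by
        rw [totalDegree_monomial _ one_ne_zero]
        rfl
      have := hb i
      omega
    exact ih _ hlt _ le_rfl
  have hM : M = ⊤ := by
    rw [eq_top_iff]
    rintro a -
    obtain ⟨p, rfl⟩ := Ideal.Quotient.mk_surjective a
    exact hmem _ p le_rfl
  have : Module.Finite ℂ A :=
    ⟨hM ▸ Submodule.fg_span ((Finsupp.finite_of_degree_le D).image _)⟩
  let Φ : {x : σ → ℂ | ∀ p ∈ I, eval x p = 0} → (A →ₐ[ℂ] ℂ) := fun x =>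
    Ideal.Quotient.liftₐ I (aeval x.1) x.2
  have hΦ : Function.Injective Φ := fun x y hxy => by
    ext i
    have h1 : aeval x.1 (X i : MvPolynomial σ ℂ) = aeval y.1 (X i : MvPolynomial σ ℂ) :=
      DFunLike.congr_fun hxy (Ideal.Quotient.mk I (X i))
    simpa using h1
  have := Finite.of_injective Φ hΦ
  exact Set.toFinite _

/-- A family of forms has finitely many common zeros on the affine hypersurface `Q = 1` if it has
no common zero on the hypersurface `Q = 0` at infinity. -/
theorem finite_of_no_zero_at_infinity {σ ι : Type} [Fintype σ] {J : ι → MvPolynomial σ ℂ}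
    {e : ι → ℕ} (hJ : ∀ j, (J j).IsHomogeneous (e j)) {Q : MvPolynomial σ ℂ} {d : ℕ}
    (hQ : Q.IsHomogeneous d) (hd : d ≠ 0)
    (h : ∀ x, (∀ j, eval x (J j) = 0) → eval x Q = 0 → x = 0) :
    {x | (∀ j, eval x (J j) = 0) ∧ eval x Q = 1}.Finite := by
  let I₀ : Ideal (MvPolynomial σ ℂ) := Ideal.span (Set.range J)
  have hX : ∀ i, ∃ k, X i ^ k ∈ I₀ ⊔ Ideal.span {Q} := by
    intro i
    have : (X i : MvPolynomial σ ℂ) ∈ (I₀ ⊔ Ideal.span {Q}).radical := by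
      rw [← vanishingIdeal_zeroLocus_eq_radical (K := ℂ)]
      intro x hx
      have hx0 : x = 0 := by
        refine h x (fun j => ?_) ?_
        · exact hx _ (Ideal.mem_sup_left (Ideal.subset_span ⟨j, rfl⟩))
        · exact hx _ (Ideal.mem_sup_right (Ideal.subset_span rfl))
      simp [hx0]
    exact this
  choose k hk using hX
  let N := d + ∑ i, k i
  have hXN : ∀ i, ∃ b : MvPolynomial σ ℂ, b.totalDegree < N ∧ X i ^ N - b * Q ∈ I₀ := by
    intro i
    have hki : k i ≤ N := (Finset.single_le_sum (fun _ _ => Nat.zero_le _)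
      (Finset.mem_univ i)).trans (Nat.le_add_left _ d)
    obtain ⟨a, ha, q, hq, haq⟩ := Submodule.mem_sup.mp (Ideal.pow_mem_of_pow_mem _ (hk i) hki)
    obtain ⟨b, rfl⟩ := Ideal.mem_span_singleton'.mp hq
    have hdN : d ≤ N := Nat.le_add_right _ _
    refine ⟨homogeneousComponent (N - d) b, ?_, ?_⟩
    · have := (homogeneousComponent_isHomogeneous (N - d) b).totalDegree_le
      omega
    · have hhom : homogeneousComponent N a ∈ I₀ := by
        refine homogeneousComponent_mem_of_mem ?_ ha N
        let _ := MvPolynomial.gradedAlgebra (σ := σ) (R := ℂ)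
        refine Ideal.homogeneous_span _ _ ?_
        rintro _ ⟨j, rfl⟩
        exact ⟨e j, hJ j⟩
      have hcomp := congrArg (homogeneousComponent N) haq
      rw [map_add, homogeneousComponent_mul_of_isHomogeneous hQ hdN,
        homogeneousComponent_eq_self (isHomogeneous_X_pow i N)] at hcomp
      rw [← hcomp, add_sub_cancel_right]
      exact hhom
  choose b hb hbI using hXN
  refine (finite_of_pow_sub_mem (I₀ ⊔ Ideal.span {Q - 1}) b hb fun i => ?_).subset ?_
  · have : (X i ^ N - b i : MvPolynomial σ ℂ) = (X i ^ N - b i * Q) + b i * (Q - 1) := by ring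
    rw [this]
    exact add_mem (Ideal.mem_sup_left (hbI i))
      (Ideal.mem_sup_right (Ideal.mul_mem_left _ _ (Ideal.mem_span_singleton_self _)))
  · rintro x ⟨hxJ, hxQ⟩
    have hle : I₀ ⊔ Ideal.span {Q - 1} ≤ RingHom.ker (eval x) := by
      refine sup_le (Ideal.span_le.mpr ?_) (Ideal.span_le.mpr ?_)
      · rintro _ ⟨j, rfl⟩
        exact hxJ j
      · rintro _ rfl
        simp [hxQ]
    exact fun p hp => hle hp

/-! ### Singular points and reducibility in the pencil -/

theorem quadric_isHomogeneous : quadric.IsHomogeneous 2 :=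
  IsHomogeneous.sum _ _ _ fun i _ => isHomogeneous_X_pow i 2

theorem pderiv_quadric (i : Fin 4) : pderiv i quadric = 2 * X i := by
  fin_cases i <;> simp [quadric, Fin.sum_univ_four, Derivation.leibniz_pow, pderiv_X]

theorem vanishesAt_mk {G : Poly4} {d : ℕ} (hG : G.IsHomogeneous d) {x : Fin 4 → ℂ} (hx : x ≠ 0) :
    VanishesAt G (Projectivization.mk ℂ x hx) ↔ eval x G = 0 := by
  obtain ⟨a, ha⟩ := Projectivization.exists_smul_eq_mk_rep ℂ x hx
  rw [VanishesAt, ← ha, Units.smul_def, eval_smul_of_isHomogeneous hG]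
  simp

theorem eval_pderiv_pencil_of_quadric_eq_zero (S : Poly4) (l : ℂ) {m : ℕ} (hm : 2 ≤ m)
    {x : Fin 4 → ℂ} (hx : eval x quadric = 0) (i : Fin 4) :
    eval x (pderiv i (S + C l * quadric ^ m)) = eval x (pderiv i S) := by
  simp [Derivation.leibniz, Derivation.leibniz_pow, hx, show m - 1 ≠ 0 by omega]

theorem isHomogeneous_pencil {S : Poly4} {m : ℕ} (hS : S.IsHomogeneous (2 * m)) (l : ℂ) :
    (S + C l * quadric ^ m).IsHomogeneous (2 * m) :=
  hS.add ((quadric_isHomogeneous.pow m).C_mul l)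

/-- A surface without singular points on the quadric has only finitely many singular points. -/
theorem finite_singularPoints {F : Poly4} {n : ℕ} (hF : F.IsHomogeneous n)
    (hreg : ∀ x, eval x quadric = 0 → (∀ i, eval x (pderiv i F) = 0) → x = 0) :
    (singularPoints F).Finite := by
  have hfin := finite_of_no_zero_at_infinity (J := fun i => pderiv i F) (fun i => hF.pderiv)
    quadric_isHomogeneous two_ne_zero fun x hJ hQ => hreg x hQ hJ
  have hscale : ∀ p ∈ singularPoints F, ∃ a : ℂ, a ^ 2 * eval p.rep quadric = 1 := by
    intro p hp
    have hQ : eval p.rep quadric ≠ 0 := fun hQ => p.rep_nonzero (hreg _ hQ hp.2)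
    obtain ⟨a, ha⟩ := IsAlgClosed.exists_pow_nat_eq (eval p.rep quadric)⁻¹ two_pos
    exact ⟨a, by rw [ha, inv_mul_cancel₀ hQ]⟩
  choose! a ha using hscale
  refine Set.Finite.of_injOn (f := fun p => a p • p.rep) ?_ ?_ hfin
  · intro p hp
    refine ⟨fun i => ?_, ?_⟩
    · rw [eval_smul_of_isHomogeneous hF.pderiv, hp.2 i, mul_zero]
    · rw [eval_smul_of_isHomogeneous quadric_isHomogeneous, ha p hp]
  · intro p hp q hq hpq
    have ha0 : a p ≠ 0 := by
      intro h0
      simpa [h0] using ha p hp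
    rw [← p.mk_rep, ← q.mk_rep, Projectivization.mk_eq_mk_iff']
    refine ⟨(a p)⁻¹ * a q, ?_⟩
    have : a p • p.rep = a q • q.rep := hpq
    rw [mul_smul, ← this, smul_smul, inv_mul_cancel₀ ha0, one_smul]

/-- Distinct points are separated by a linear form, so points are Zariski closed. -/
theorem exists_linear_form {p q : P3} (h : p ≠ q) :
    ∃ G : Poly4, G.IsHomogeneous 1 ∧ VanishesAt G q ∧ ¬ VanishesAt G p := by
  by_contra! hG
  obtain ⟨j, hj⟩ : ∃ j, q.rep j ≠ 0 := by
    by_contra! h0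
    exact q.rep_nonzero (funext h0)
  apply h
  rw [← p.mk_rep, ← q.mk_rep, Projectivization.mk_eq_mk_iff']
  refine ⟨p.rep j / q.rep j, funext fun i => ?_⟩
  have := hG (C (q.rep j) * X i - C (q.rep i) * X j)
    (((isHomogeneous_X ℂ i).C_mul _).sub ((isHomogeneous_X ℂ j).C_mul _))
    (by simp [VanishesAt, mul_comm])
  have h2 : q.rep j * p.rep i - q.rep i * p.rep j = 0 := by simpa [VanishesAt] using this
  simp only [Pi.smul_apply, smul_eq_mul]
  field_simp
  linear_combination -h2

theorem hasOnlyIsolatedSingularities_of_finite {F : Poly4} (h : (singularPoints F).Finite) :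
    HasOnlyIsolatedSingularities F := by
  intro p hp
  have hsep : ∀ q, p ≠ q → ∃ G : Poly4, G.IsHomogeneous 1 ∧ VanishesAt G q ∧ ¬ VanishesAt G p :=
    fun q => exists_linear_form
  choose! G hG1 hGq hGp using hsep
  let _ := zariski
  refine ⟨⋂ q ∈ singularPoints F \ {p}, {r | ¬ VanishesAt (G q) r}, ?_, ?_⟩
  · refine (h.subset Set.sdiff_subset).isOpen_biInter fun q hq => ?_
    exact TopologicalSpace.isOpen_generateFrom_of_mem ⟨1, G q, hG1 q (Ne.symm hq.2), rfl⟩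
  · ext r
    simp only [Set.mem_inter_iff, Set.mem_iInter, Set.mem_singleton_iff]
    constructor
    · rintro ⟨hr, hrs⟩
      by_contra hrp
      exact hr r ⟨hrs, hrp⟩ (hGq r (Ne.symm hrp))
    · rintro rfl
      exact ⟨fun q hq => hGp q (Ne.symm hq.2), hp⟩

theorem kaehlerDifferential_algHom_apply {A : Type*} [CommRing A] [Algebra ℂ A]
    (π : Poly4 →ₐ[ℂ] A) (f : Poly4) : KaehlerDifferential.D ℂ A (π f) =
      ∑ i, π (pderiv i f) • KaehlerDifferential.D ℂ A (π (X i)) := by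
  induction f using MvPolynomial.induction_on with
  | C a =>
    have : π (C a) = algebraMap ℂ A a := π.commutes a
    simp [this]
  | add p q hp hq => simp only [map_add, add_smul, Finset.sum_add_distrib, hp, hq]
  | mul_X p j hp =>
    simp only [map_mul, Derivation.leibniz, hp, Finset.smul_sum, smul_eq_mul, map_add, add_smul,
      Finset.sum_add_distrib, mul_smul, pderiv_X, Pi.single_apply]
    simp

/-- If `Q = 1` and the gradient of `S` is proportional to that of `Q`, then `dS = 0`. -/
theorem kaehlerDifferential_eq_zero_of_quadric_eq_one {A : Type*} [CommRing A] [Algebra ℂ A]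
    (π : Poly4 →ₐ[ℂ] A) {S : Poly4} {c : A} (hQ : π quadric = 1)
    (hS : ∀ i, π (pderiv i S) = c * π (pderiv i quadric)) :
    KaehlerDifferential.D ℂ A (π S) = 0 := by
  have hDQ := kaehlerDifferential_algHom_apply π quadric
  rw [hQ, Derivation.map_one_eq_zero] at hDQ
  rw [kaehlerDifferential_algHom_apply]
  simp_rw [hS, mul_smul, ← Finset.smul_sum]
  rw [← hDQ, smul_zero]

/-- The critical values of `S` on the affine quadric `Q = 1`. By Euler's identity the Lagrange
condition for a form `S` of degree `2 m` is that its gradient is `2 m S` times the position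
vector. -/
theorem finite_critical_values (S : Poly4) (m : ℕ) :
    ((fun x => eval x S) '' {x | eval x quadric = 1 ∧
      ∀ i, eval x (pderiv i S) = 2 * m * eval x S * x i}).Finite := by
  let I : Ideal Poly4 := Ideal.span (insert (quadric - 1)
    (Set.range fun i => pderiv i S - 2 * (m : Poly4) * S * X i))
  have hDS : KaehlerDifferential.D ℂ (Poly4 ⧸ I) (Ideal.Quotient.mkₐ ℂ I S) = 0 := by
    refine kaehlerDifferential_eq_zero_of_quadric_eq_one (Ideal.Quotient.mkₐ ℂ I)
      (c := Ideal.Quotient.mkₐ ℂ I ((m : Poly4) * S)) ?_ fun i => ?_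
    · rw [← map_one (Ideal.Quotient.mkₐ ℂ I)]
      exact Ideal.Quotient.eq.mpr (Ideal.subset_span (Set.mem_insert _ _))
    · rw [← map_mul, pderiv_quadric]
      refine Ideal.Quotient.eq.mpr ?_
      have hi : pderiv i S - 2 * (m : Poly4) * S * X i ∈ I :=
        Ideal.subset_span (Set.mem_insert_of_mem _ ⟨i, rfl⟩)
      rwa [show pderiv i S - (m : Poly4) * S * (2 * X i) =
        pderiv i S - 2 * (m : Poly4) * S * X i by ring]
  refine (finite_eval_image_of_kaehlerDifferential_eq_zero I S hDS).subset ?_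
  refine Set.image_mono ?_
  rintro x ⟨hQ, hx⟩
  have hle : I ≤ RingHom.ker (eval x) := by
    refine Ideal.span_le.mpr ?_
    rintro _ (rfl | ⟨i, rfl⟩)
    · change eval x _ = 0
      simp [hQ]
    · change eval x _ = 0
      simp [hx i]
  exact fun p hp => hle hp

theorem finite_not_isSmoothSurface {S : Poly4} {m : ℕ} (hm : 2 ≤ m)
    (hS : S.IsHomogeneous (2 * m))
    (hreg : ∀ x, eval x quadric = 0 → (∀ i, eval x (pderiv i S) = 0) → x = 0) :
    {l : ℂ | ¬ IsSmoothSurface (S + C l * quadric ^ m)}.Finite := by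
  refine ((finite_critical_values S m).image fun c => -c).subset ?_
  intro l hl
  obtain ⟨p, hp, hpi⟩ := Set.nonempty_iff_ne_empty.mpr hl
  have hQ : eval p.rep quadric ≠ 0 := fun hQ => p.rep_nonzero (hreg _ hQ fun i => by
    rw [← eval_pderiv_pencil_of_quadric_eq_zero S l hm hQ]
    exact hpi i)
  obtain ⟨a, ha⟩ := IsAlgClosed.exists_pow_nat_eq (eval p.rep quadric)⁻¹ two_pos
  set x := a • p.rep with hx
  have hxQ : eval x quadric = 1 := by
    rw [hx, eval_smul_of_isHomogeneous quadric_isHomogeneous, ha, inv_mul_cancel₀ hQ]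
  have hF := isHomogeneous_pencil hS l
  have hxF : eval x (S + C l * quadric ^ m) = 0 := by
    rw [hx, eval_smul_of_isHomogeneous hF, hp, mul_zero]
  have hxi : ∀ i, eval x (pderiv i (S + C l * quadric ^ m)) = 0 := fun i => by
    rw [hx, eval_smul_of_isHomogeneous hF.pderiv, hpi i, mul_zero]
  have hl : eval x S = -l := by
    rw [map_add, map_mul, map_pow, hxQ, eval_C] at hxF
    linear_combination hxF
  refine ⟨-l, ⟨x, ⟨hxQ, fun i => ?_⟩, hl⟩, neg_neg l⟩
  have := hxi i
  simp [Derivation.leibniz, Derivation.leibniz_pow, hxQ, pderiv_quadric] at this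
  rw [hl]
  linear_combination this

/-- A form with no singular point on the quadric that vanishes on a line of the quadric is
irreducible: otherwise one factor vanishes on the line and the other one at a point of it. -/
theorem irreducible_of_line {F : Poly4} {n : ℕ} (hn : n ≠ 0) (hF : F.IsHomogeneous n)
    (hreg : ∀ x, eval x quadric = 0 → (∀ i, eval x (pderiv i F) = 0) → x = 0)
    {line : Fin 4 → MvPolynomial (Fin 2) ℂ} (hline : ∀ i, (line i).IsHomogeneous 1)
    (hinj : ∀ v, (∀ i, eval v (line i) = 0) → v = 0) (hQ : bind₁ line quadric = 0)
    (hFl : bind₁ line F = 0) : Irreducible F := by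
  have heval : ∀ (G : Poly4) (v : Fin 2 → ℂ),
      eval v (bind₁ line G) = eval (fun i => eval v (line i)) G := fun G v =>
    aeval_bind₁ v line G
  have key : ∀ p q : Poly4, ∀ d, d ≠ 0 → q.IsHomogeneous d → F = p * q → bind₁ line p ≠ 0 := by
    rintro p q d hd hq rfl hp
    obtain ⟨v, hv, hvq⟩ := exists_ne_zero_eval_eq_zero
      (by simpa using hq.aeval line hline) hd
    refine hv (hinj v fun i => congrFun (hreg (fun i => eval v (line i)) ?_ ?_) i)
    · rw [← heval, hQ, map_zero]
    · intro i
      rw [heval] at hvq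
      have hvp : eval (fun i => eval v (line i)) p = 0 := by rw [← heval, hp, map_zero]
      simp [Derivation.leibniz, hvp, hvq]
  have hF0 : F ≠ 0 := by
    rintro rfl
    have h1 : (![1, 0] : Fin 2 → ℂ) = 0 := by
      refine hinj _ fun i => congrFun (hreg (fun i => eval ![1, 0] (line i)) ?_ fun j => ?_) i
      · rw [← heval, hQ, map_zero]
      · simp
    exact one_ne_zero (congrFun h1 0)
  -- In a polynomial ring over a field the nonzero constants are units.
  have htd : ∀ p : Poly4, p ≠ 0 → ¬ IsUnit p → p.totalDegree ≠ 0 := by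
    intro p hp hu hd
    rw [totalDegree_eq_zero_iff_eq_C] at hd
    refine hu ?_
    rw [hd]
    refine (IsUnit.mk0 _ fun hc => hp ?_).map C
    rw [hd, hc, C_0]
  refine ⟨fun hu => ?_, fun p q hpq => ?_⟩
  · have := hu.map (eval (0 : Fin 4 → ℂ))
    have h0 := eval_smul_of_isHomogeneous hF 0 0
    rw [zero_smul, zero_pow hn, zero_mul] at h0
    rw [h0] at this
    exact not_isUnit_zero this
  · by_contra! hu
    have hpq0 : p * q ≠ 0 := hpq ▸ hF0
    have hfac := hpq.trans (eq_homogeneousComponent_mul (hpq ▸ hF) hpq0)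
    have h1 := key _ _ _ (htd q (right_ne_zero_of_mul hpq0) hu.2)
      (homogeneousComponent_isHomogeneous _ _) hfac
    have h2 := key _ _ _ (htd p (left_ne_zero_of_mul hpq0) hu.1)
      (homogeneousComponent_isHomogeneous _ _) (hfac.trans (mul_comm _ _))
    rw [hfac, map_mul] at hFl
    exact mul_ne_zero h1 h2 hFl

theorem isReducedSurface_of_irreducible {F : Poly4} (hF : Irreducible F) : IsReducedSurface F :=
  ((Ideal.span_singleton_prime hF.ne_zero).mpr hF.prime).isRadical

/-- By the Nullstellensatz the surface of an irreducible form is irreducible. -/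
theorem isIrreducibleSurface_of_irreducible {F : Poly4} {n : ℕ} (hF : F.IsHomogeneous n)
    (hirr : Irreducible F) (hne : (surface F).Nonempty) : IsIrreducibleSurface F := by
  let _ := zariski
  have hprime : (Ideal.span {F}).IsPrime :=
    (Ideal.span_singleton_prime hirr.ne_zero).mpr hirr.prime
  have key : ∀ (d : ℕ) (G : Poly4), G.IsHomogeneous d → (∀ p ∈ surface F, VanishesAt G p) →
      F ∣ G := by
    intro d G hG hvan
    rw [← Ideal.mem_span_singleton, ← IsPrime.vanishingIdeal_zeroLocus (K := ℂ) (Ideal.span {F})]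
    intro x hx
    have hxF : eval x F = 0 := hx F (Ideal.mem_span_singleton_self F)
    by_cases hx0 : x = 0
    · obtain ⟨p, hp⟩ := hne
      have h0 := eval_smul_of_isHomogeneous hG 0 p.rep
      rw [zero_smul, hvan p hp, mul_zero] at h0
      rw [hx0]
      exact h0
    · exact (vanishesAt_mk hG hx0).mp (hvan _ ((vanishesAt_mk hF hx0).mpr hxF))
  have hbasis := TopologicalSpace.isTopologicalBasis_of_subbasis_of_inter
    (r := {U : Set P3 | ∃ (d : ℕ) (G : Poly4), G.IsHomogeneous d ∧ U = {p | ¬ VanishesAt G p}})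
    rfl (by
      rintro _ ⟨d, G, hG, rfl⟩ _ ⟨e, H, hH, rfl⟩
      refine ⟨d + e, G * H, hG.mul hH, ?_⟩
      ext p
      simp [VanishesAt])
  have hopen : ∀ U : Set P3, IsOpen U → ∀ p ∈ U, ∃ (d : ℕ) (G : Poly4), G.IsHomogeneous d ∧
      ¬ VanishesAt G p ∧ ∀ q, ¬ VanishesAt G q → q ∈ U := by
    intro U hU p hp
    obtain ⟨V, hV, hpV, hVU⟩ := hbasis.exists_subset_of_mem_open hp hU
    obtain rfl | ⟨d, G, hG, rfl⟩ := hV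
    · exact ⟨0, 1, isHomogeneous_one _ _, by simp [VanishesAt], fun q _ => hVU trivial⟩
    · exact ⟨d, G, hG, hpV, fun q hq => hVU hq⟩
  refine ⟨hne, fun U V hU hV ⟨p, hpF, hpU⟩ ⟨q, hqF, hqV⟩ => ?_⟩
  obtain ⟨d, G, hG, hGp, hGU⟩ := hopen U hU p hpU
  obtain ⟨e, H, hH, hHq, hHV⟩ := hopen V hV q hqV
  by_contra hempty
  have hdvd : F ∣ G * H := by
    refine key _ _ (hG.mul hH) fun r hr => ?_
    by_contra hr'
    rw [VanishesAt, map_mul, mul_eq_zero, not_or] at hr'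
    exact hempty ⟨r, hr, hGU r hr'.1, hHV r hr'.2⟩
  have hvan : ∀ {G : Poly4}, F ∣ G → ∀ r ∈ surface F, VanishesAt G r := by
    rintro _ ⟨K, rfl⟩ r hr
    have : eval r.rep F = 0 := hr
    simp [VanishesAt, this]
  obtain h | h := hirr.prime.dvd_or_dvd hdvd
  · exact hGp (hvan h p hpF)
  · exact hHq (hvan h q hqF)

/-! ### Degrees of the invariants and their base lines -/

theorem symSum_isHomogeneous {v : Fin 4 → Poly4} {k : ℕ} (hv : ∀ i, (v i).IsHomogeneous k)
    (e : Fin 4 → ℕ) : (symSum v e).IsHomogeneous (k * ∑ i, e i) := by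
  refine IsHomogeneous.sum _ _ _ fun d hd => ?_
  obtain ⟨s, -, rfl⟩ := Finset.mem_image.mp hd
  have : k * ∑ i, e i = ∑ i, k * (e ∘ s) i := by
    rw [← Finset.mul_sum, Function.comp_def, Equiv.sum_comp s e]
  rw [this]
  exact IsHomogeneous.prod _ _ _ fun i _ => (hv i).pow _

theorem isHomogeneous_ofNat_mul {σ R : Type*} [CommRing R] {p : MvPolynomial σ R} {d : ℕ}
    (hp : p.IsHomogeneous d) (n : ℕ) [n.AtLeastTwo] :
    ((ofNat(n) : MvPolynomial σ R) * p).IsHomogeneous d := by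
  rw [← map_ofNat (C : R →+* MvPolynomial σ R)]
  exact hp.C_mul _

theorem S6_isHomogeneous : S6.IsHomogeneous (2 * 3) :=
  (symSum_isHomogeneous (isHomogeneous_X ℂ) ![6, 0, 0, 0]).add
    (isHomogeneous_ofNat_mul (symSum_isHomogeneous (isHomogeneous_X ℂ) ![2, 2, 2, 0]) 15)

theorem S8_isHomogeneous : S8.IsHomogeneous (2 * 4) := by
  have hX : ∀ i, (X i ^ 2 : Poly4).IsHomogeneous 2 := fun i => isHomogeneous_X_pow i 2
  exact ((symSum_isHomogeneous (isHomogeneous_X ℂ) ![8, 0, 0, 0]).add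
    (isHomogeneous_ofNat_mul (symSum_isHomogeneous (isHomogeneous_X ℂ) ![4, 4, 0, 0]) 14)).add
    (isHomogeneous_ofNat_mul ((((hX 0).mul (hX 1)).mul (hX 2)).mul (hX 3)) 168)

theorem S12_isHomogeneous : S12.IsHomogeneous (2 * 6) := by
  have hX : ∀ i, (X i ^ 2 : Poly4).IsHomogeneous 2 := fun i => isHomogeneous_X_pow i 2
  have hs : ∀ (c : ℕ) [c.AtLeastTwo] (e : Fin 4 → ℕ), ∑ i, e i = 6 →
      ((ofNat(c) : Poly4) * symSum (fun i => X i ^ 2) e).IsHomogeneous (2 * 6) :=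
    fun c _ e he => isHomogeneous_ofNat_mul (he ▸ symSum_isHomogeneous hX e) c
  refine IsHomogeneous.add ?_ (IsHomogeneous.C_mul ?_ _)
  · exact (((((((hs 2 ![5, 1, 0, 0] rfl).sub (hs 6 ![4, 2, 0, 0] rfl)).sub
      (hs 12 ![4, 1, 1, 0] rfl)).add (hs 14 ![3, 3, 0, 0] rfl)).add
      (hs 9 ![3, 2, 1, 0] rfl)).add (hs 348 ![3, 1, 1, 1] rfl)).add
      (hs 30 ![2, 2, 2, 0] rfl)).sub (hs 270 ![2, 2, 1, 1] rfl)
  · rw [S12anti_eq]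
    have hd : ∀ i j, (X i ^ 2 - X j ^ 2 : Poly4).IsHomogeneous 2 := fun i j => (hX i).sub (hX j)
    exact (((((hd 1 0).mul (hd 2 0)).mul (hd 2 1)).mul (hd 3 0)).mul (hd 3 1)).mul (hd 3 2)

/-- The line of the quadric with first Segre parameter `u`, parametrized by the second one. -/
noncomputable def segreLine (u : Fin 2 → ℂ) : Fin 4 → MvPolynomial (Fin 2) ℂ :=
  ![C (u 0) * X 0 + C (u 1) * X 1, C Complex.I * (C (u 0) * X 0 - C (u 1) * X 1),
    C (u 0) * X 1 - C (u 1) * X 0, C Complex.I * (C (u 0) * X 1 + C (u 1) * X 0)]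

theorem eval_segreLine (u v : Fin 2 → ℂ) : (fun i => eval v (segreLine u i)) = segrePoint u v := by
  funext i
  fin_cases i <;> simp [segreLine, segrePoint]

theorem segreLine_isHomogeneous (u : Fin 2 → ℂ) (i : Fin 4) :
    (segreLine u i).IsHomogeneous 1 := by
  have h : ∀ a j, (C (u a) * X j : MvPolynomial (Fin 2) ℂ).IsHomogeneous 1 :=
    fun a j => (isHomogeneous_X ℂ j).C_mul _
  fin_cases i
  · exact (h 0 0).add (h 1 1)
  · exact ((h 0 0).sub (h 1 1)).C_mul _
  · exact (h 0 1).sub (h 1 0)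
  · exact ((h 0 1).add (h 1 0)).C_mul _

theorem bind₁_segreLine_eq_zero {u : Fin 2 → ℂ} {G : Poly4}
    (h : ∀ v, eval (segrePoint u v) G = 0) : bind₁ (segreLine u) G = 0 := by
  refine MvPolynomial.funext fun v => ?_
  have : eval v (bind₁ (segreLine u) G) = eval (fun i => eval v (segreLine u i)) G :=
    aeval_bind₁ v _ G
  rw [this, eval_segreLine, h, map_zero]

theorem S6_vanishes_on_line : ∃ u : Fin 2 → ℂ, u ≠ 0 ∧ ∀ v, eval (segrePoint u v) S6 = 0 := by
  refine ⟨![1, 0], fun h => one_ne_zero (congrFun h 0), fun v => ?_⟩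
  rw [S6_eq]
  simp only [map_add, map_sub, map_mul, map_pow, map_ofNat, eval_elemSym, segrePoint_sq]
  simp only [elemSym, segreSq, Matrix.cons_val]
  ring

theorem S8_vanishes_on_line : ∃ u : Fin 2 → ℂ, u ≠ 0 ∧ ∀ v, eval (segrePoint u v) S8 = 0 := by
  -- The roots of `w² + 14 w + 1` are `-7 ± √48`, and `w = t⁴`.
  obtain ⟨r, hr⟩ := IsAlgClosed.exists_pow_nat_eq (48 : ℂ) two_pos
  obtain ⟨t, ht⟩ := IsAlgClosed.exists_pow_nat_eq (r - 7) (n := 4) (by norm_num)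
  have hroot : t ^ 8 + 14 * t ^ 4 + 1 = 0 := by
    linear_combination (t ^ 4 + r + 7) * ht + hr
  refine ⟨![t, 1], fun h => one_ne_zero (congrFun h 1), fun v => ?_⟩
  rw [S8_eq]
  simp only [map_add, map_sub, map_mul, map_pow, map_ofNat, eval_elemSym, segrePoint_sq]
  simp only [elemSym, segreSq, Matrix.cons_val]
  linear_combination 16 * (v 0 ^ 8 + 14 * v 0 ^ 4 * v 1 ^ 4 + v 1 ^ 8) * hroot

theorem S12_vanishes_on_line : ∃ u : Fin 2 → ℂ, u ≠ 0 ∧ ∀ v, eval (segrePoint u v) S12 = 0 := by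
  have hs := sqrt_five_sq
  have hI : Complex.I ^ 2 = -1 := Complex.I_sq
  set s : ℂ := ((Real.sqrt 5 : ℝ) : ℂ) with hs_def
  obtain ⟨t, ht⟩ := IsAlgClosed.exists_pow_nat_eq ((1 + 2 * Complex.I) * s / 5) two_pos
  -- The icosahedral form is divisible by this quadratic polynomial in `t ^ 2`.
  have hquad : 5 * t ^ 4 - 2 * s * t ^ 2 + 5 = 0 := by
    rw [show t ^ 4 = (t ^ 2) ^ 2 by ring, ht]
    linear_combination (4 * s ^ 2 / 5) * hI - hs
  have hroot : 5 * (t ^ 12 + 1) - 22 * s * (t ^ 10 + t ^ 2) - 165 * (t ^ 8 + t ^ 4)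
      + 44 * s * t ^ 6 = 0 := by
    linear_combination (t ^ 8 + 1 - 4 * s * (t ^ 6 + t ^ 2) - 42 * t ^ 4) * hquad
      - (8 * (t ^ 8 + t ^ 4)) * hs
  refine ⟨![t, 1], fun h => one_ne_zero (congrFun h 1), fun v => ?_⟩
  rw [S12, S12symm_eq, S12anti_eq]
  have hV : eval (segrePoint ![t, 1] v) (vandermonde4 fun i => (X i ^ 2 : Poly4)) =
      vandermonde4 (segreSq ![t, 1] v) := by
    rw [← segrePoint_sq]
    simp [vandermonde4]
  simp only [map_add, map_sub, map_mul, map_pow, map_ofNat, eval_elemSym, segrePoint_sq, eval_C,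
    hV, ← hs_def]
  simp only [elemSym, segreSq, Matrix.cons_val, vandermonde4]
  linear_combination (-6 / 5 * (5 * (v 0 ^ 12 + v 1 ^ 12)
      - 22 * s * (v 0 ^ 10 * v 1 ^ 2 + v 0 ^ 2 * v 1 ^ 10)
      - 165 * (v 0 ^ 8 * v 1 ^ 4 + v 0 ^ 4 * v 1 ^ 8) + 44 * s * v 0 ^ 6 * v 1 ^ 6)) * hroot
    - (-6 / 5 * (-22 * (t ^ 10 + t ^ 2) + 44 * t ^ 6) *
      (-22 * (v 0 ^ 10 * v 1 ^ 2 + v 0 ^ 2 * v 1 ^ 10) + 44 * v 0 ^ 6 * v 1 ^ 6)) * hs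

/-! ### The pencils -/

/-- The properties of a pencil `S + l Qᵐ` follow from two facts about the restriction of `S` to
the quadric: the gradient of `S` has no zero there, and `S` vanishes on a line of the quadric. -/
theorem pencil_properties {S : Poly4} {m : ℕ} (hm : 2 ≤ m) (hS : S.IsHomogeneous (2 * m))
    (hreg : ∀ x, eval x quadric = 0 → (∀ i, eval x (pderiv i S) = 0) → x = 0)
    (hline : ∃ u : Fin 2 → ℂ, u ≠ 0 ∧ ∀ v, eval (segrePoint u v) S = 0) :
    (∀ l : ℂ, ∀ p ∈ singularPoints (S + C l * quadric ^ m), p ∉ surface quadric) ∧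
    {l : ℂ | ¬ IsSmoothSurface (S + C l * quadric ^ m)}.Finite ∧
    (∀ l : ℂ, (singularPoints (S + C l * quadric ^ m)).Finite ∧
      HasOnlyIsolatedSingularities (S + C l * quadric ^ m)) ∧
    (∀ l : ℂ, Irreducible (S + C l * quadric ^ m) ∧
      IsIrreducibleSurface (S + C l * quadric ^ m) ∧
      IsReducedSurface (S + C l * quadric ^ m)) := by
  have hF := isHomogeneous_pencil hS
  have hregF : ∀ (l : ℂ) (x : Fin 4 → ℂ), eval x quadric = 0 →
      (∀ i, eval x (pderiv i (S + C l * quadric ^ m)) = 0) → x = 0 := fun l x hx h =>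
    hreg x hx fun i => by rw [← eval_pderiv_pencil_of_quadric_eq_zero S l hm hx, h i]
  refine ⟨fun l p hp hpQ => p.rep_nonzero (hregF l _ hpQ hp.2),
    finite_not_isSmoothSurface hm hS hreg, fun l => ?_, fun l => ?_⟩
  · have hfin := finite_singularPoints (hF l) (hregF l)
    exact ⟨hfin, hasOnlyIsolatedSingularities_of_finite hfin⟩
  · obtain ⟨u, hu, huS⟩ := hline
    have hpoint : ∀ v, eval (segrePoint u v) (S + C l * quadric ^ m) = 0 := fun v => by
      simp [huS, eval_segrePoint_quadric, show m ≠ 0 by omega]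
    have hinj : ∀ v, segrePoint u v = 0 → v = 0 := fun v hv =>
      (eq_zero_of_segrePoint_eq_zero hv).resolve_left hu
    have hirr : Irreducible (S + C l * quadric ^ m) :=
      irreducible_of_line (by omega) (hF l) (hregF l) (segreLine_isHomogeneous u)
        (fun v hv => hinj v ((eval_segreLine u v).symm.trans (funext hv)))
        (bind₁_segreLine_eq_zero (eval_segrePoint_quadric u)) (bind₁_segreLine_eq_zero hpoint)
    have hne : segrePoint u ![1, 0] ≠ 0 := fun h => one_ne_zero (congrFun (hinj _ h) 0)
    exact ⟨hirr, isIrreducibleSurface_of_irreducible (hF l) hirr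
      ⟨_, (vanishesAt_mk (hF l) hne).mpr (hpoint _)⟩, isReducedSurface_of_irreducible hirr⟩

theorem mainTheorem5 (n : ℕ) (hn : n = 6 ∨ n = 8 ∨ n = 12) :
    (∀ l : OnePoint ℂ, l ≠ ∞ →
      ∀ p ∈ singularPoints (pencilMember n l), p ∉ surface quadric) ∧
    {l : OnePoint ℂ | ¬ IsSmoothSurface (pencilMember n l)}.Finite ∧
    (∀ l : OnePoint ℂ, l ≠ ∞ →
      (singularPoints (pencilMember n l)).Finite ∧
      HasOnlyIsolatedSingularities (pencilMember n l)) ∧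
    (∀ l : OnePoint ℂ, l ≠ ∞ →
      Irreducible (pencilMember n l) ∧
      IsIrreducibleSurface (pencilMember n l) ∧
      IsReducedSurface (pencilMember n l)) := by
  obtain ⟨h1, h2, h3, h4⟩ :
      (∀ l : ℂ, ∀ p ∈ singularPoints (pencilMember n l), p ∉ surface quadric) ∧
      {l : ℂ | ¬ IsSmoothSurface (pencilMember n l)}.Finite ∧
      (∀ l : ℂ, (singularPoints (pencilMember n l)).Finite ∧
        HasOnlyIsolatedSingularities (pencilMember n l)) ∧
      (∀ l : ℂ, Irreducible (pencilMember n l) ∧ IsIrreducibleSurface (pencilMember n l) ∧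
        IsReducedSurface (pencilMember n l)) := by
    obtain rfl | rfl | rfl := hn
    · exact pencil_properties (by norm_num) S6_isHomogeneous (fun x => eq_zero_of_S6_gradient_eq_zero)
        S6_vanishes_on_line
    · exact pencil_properties (by norm_num) S8_isHomogeneous (fun x => eq_zero_of_S8_gradient_eq_zero)
        S8_vanishes_on_line
    · exact pencil_properties (by norm_num) S12_isHomogeneous (fun x => eq_zero_of_S12_gradient_eq_zero)
        S12_vanishes_on_line
  refine ⟨fun l hl => ?_, ?_, fun l hl => ?_, fun l hl => ?_⟩
  · lift l to ℂ using hl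
    exact h1 l
  · refine ((h2.image ((↑) : ℂ → OnePoint ℂ)).insert ∞).subset fun l hl => ?_
    induction l using OnePoint.rec with
    | infty => exact Set.mem_insert _ _
    | coe l => exact Set.mem_insert_of_mem _ ⟨l, hl, rfl⟩
  · lift l to ℂ using hl
    exact h3 l
  · lift l to ℂ using hl
    exact h4 l
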